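/- Let $P$ be a probability measure on $\mathbb R$, $\sigma>0$ and $a>0$. For $t\in\mathbb R$ let $P_t$ be the law of $t+\sigma\xi_1$ with $\xi_1\sim P$, and for $\theta\in\mathbb R^d$ let $P_\theta$ be the law on $\mathbb R^d$ of $X=\theta+\sigma\xi$, where $\xi=(\xi_1,\dots,\xi_d)$ has independent coordinates of law $P$. Put $\chi^2(P_0,P_a)=\int\big(\tfrac{dP_a}{dP_0}-1\big)^2dP_0$ if $P_a\ll P_0$ and $\chi^2(P_0,P_a)=\infty$ otherwise. Let $\Theta_d^+(s,a)$ be the set of $\theta\in\mathbb R^d$ for which there is $S\subseteq\{1,\dots,d\}$ with at most $s$ elements such that $\theta_j\ge a$ for $j\in S$ and $\theta_j=0$ for $j\notin S$, and let $\eta=\eta(\theta)=(\mathbf 1(\theta_j\ne0))_{j=1,\dots,d}$. Let $\mathcal Q_\alpha$ be the set of all non-interactive $\alpha$-locally differentially private mechanisms, that is, of all $Q=(Q^1,\dots,Q^n)$ where each $Q^i$ is a Markov kernel from $\mathbb R^d$ to $\mathbb R^d$ with $Q^i(A\mid x)\le e^\alpha Q^i(A\mid x')$ for all $x,x'\in\mathbb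 R^d$ and all measurable $A$. Let $Q(P_\theta^{\otimes n})$ be the law of $(Z^1,\dots,Z^n)$ when $X^1,\dots,X^n$ are i.i.d. of law $P_\theta$ and each $Z^i$ is drawn independently from $Q^i(\cdot\mid X^i)$. Let $\mathcal T$ be the set of separable selectors, that is, of measurable $\hat\eta=\hat\eta(Z^1,\dots,Z^n)\in\{0,1\}^d$ whose $j$th component depends only on $(Z^i_j)_{i=1,\dots,n}$, for every $j$. Let $|\hat\eta-\eta|=\sum_{j=1}^d\mathbf 1(\hat\eta_j\ne\eta_j)$ be the Hamming loss. (1) If $\chi^2(P_0,P_a)<\infty$, then for all $\alpha>0$ and all integers $d\ge4$, $1\le s\le d$, $n\ge1$, $$\inf_{Q\in\mathcal Q_\alpha}\inf_{\hat\eta\in\mathcal T}\sup_{\theta\in\Theta_d^+(s,a)}\mathbb E_{Q(P_\theta^{\otimes n})}|\hat\eta-\eta|\ \ge\ \frac14\left(1-\frac{2n(e^\alpha-1)^2}{d\log d}\,\chi^2(P_0,P_a)\right).$$ (2) If $P$ has a density $p=\exp(-\phi)$ with respect to Lebesgue measure, where the potential $\phi:\mathbb R\to\mathbb R$ has curvature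 at most $c_+>0$, in the sense that $$\phi(tx+(1-t)y)-\big[t\phi(x)+(1-t)\phi(y)\big]\ge-\frac{c_+}{2}\,t(1-t)(x-y)^2\qquad\text{for all }x,y\in\mathbb R,\ t\in(0,1),$$ then $$\chi^2(P_0,P_a)\le\exp\left(c_+\frac{a^2}{\sigma^2}\right)-1,$$ and in particular $\chi^2(P_0,P_a)<\infty$. -/

import Mathlib

open MeasureTheory ProbabilityTheory
open scoped ENNReal

noncomputable section

/-- The law `P_t` of the real random variable `t + σ ξ₁`, where `ξ₁` has law `P`. -/
def coordLaw (P : Measure ℝ) (σ t : ℝ) : Measure ℝ :=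
  P.map (fun u => t + σ * u)

/-- The law `P_θ` on `ℝ^d` of `X = θ + σ ξ`, where the coordinates of `ξ` are
independent with law `P`. -/
def obsLaw (P : Measure ℝ) (σ : ℝ) {d : ℕ} (θ : Fin d → ℝ) : Measure (Fin d → ℝ) :=
  Measure.pi (fun j => coordLaw P σ (θ j))

/-- The class `Θ_d^+(s,a)` of vectors with at most `s` non-zero coordinates, all of which
are at least `a`. -/
def sparseClass (d s : ℕ) (a : ℝ) : Set (Fin d → ℝ) :=
  {θ | ∃ S : Finset (Fin d), S.card ≤ s ∧ (∀ j ∈ S, a ≤ θ j) ∧ ∀ j ∉ S, θ j = 0}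

/-- The support vector `η = (I(θ_j ≠ 0))_j`; `true` stands for `1` and `false` for `0`. -/
def supportVec {d : ℕ} (θ : Fin d → ℝ) : Fin d → Bool :=
  fun j => decide (θ j ≠ 0)

/-- A Markov kernel `Q` is `α`-locally differentially private:
`Q(A | x) ≤ e^α Q(A | x')` for all inputs `x, x'` and all measurable `A`. -/
def IsPrivateKernel {𝒳 𝒵 : Type*} [MeasurableSpace 𝒳] [MeasurableSpace 𝒵]
    (α : ℝ) (Q : Kernel 𝒳 𝒵) : Prop :=
  IsMarkovKernel Q ∧ ∀ x x' : 𝒳, ∀ A : Set 𝒵, MeasurableSet A →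
    Q x A ≤ ENNReal.ofReal (Real.exp α) * Q x' A

/-- The set `𝒬_α` of non-interactive `α`-locally differentially private mechanisms
`Q = (Q^1, …, Q^n)` from `ℝ^d` to `ℝ^d` (each may act on all coordinates jointly). -/
def privateMechanisms (α : ℝ) (n d : ℕ) : Set (Fin n → Kernel (Fin d → ℝ) (Fin d → ℝ)) :=
  {Q | ∀ i, IsPrivateKernel α (Q i)}

/-- The law `Q(P_θ^{⊗ n})` of `(Z^1, …, Z^n)`: the `Z^i` are independent, and `Z^i` has law
`Q^i P_θ`, that is, `Z^i` is drawn from `Q^i(· | X^i)` with `X^i` of law `P_θ`. -/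
def privatizedLaw (P : Measure ℝ) (σ : ℝ) {n d : ℕ}
    (Q : Fin n → Kernel (Fin d → ℝ) (Fin d → ℝ)) (θ : Fin d → ℝ) :
    Measure (Fin n → Fin d → ℝ) :=
  Measure.pi (fun i => (obsLaw P σ θ).bind (Q i))

/-- The set `𝒯` of separable selectors: measurable maps `(Z^1, …, Z^n) ↦ η̂ ∈ {0,1}^d` whose
`j`-th component depends only on the `j`-th coordinates `(Z^i_j)_i`. -/
def separableSelectors (n d : ℕ) : Set ((Fin n → Fin d → ℝ) → (Fin d → Bool)) :=
  {h | Measurable h ∧ ∀ (j : Fin d) (z z' : Fin n → Fin d → ℝ),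
    (∀ i, z i j = z' i j) → h z j = h z' j}

/-- The expected Hamming loss `E |η̂ - η|` under `Q(P_θ^{⊗ n})`. -/
def hammingRisk (P : Measure ℝ) (σ : ℝ) {n d : ℕ}
    (Q : Fin n → Kernel (Fin d → ℝ) (Fin d → ℝ))
    (h : (Fin n → Fin d → ℝ) → (Fin d → Bool)) (θ : Fin d → ℝ) : ℝ≥0∞ :=
  ∫⁻ z, (hammingDist (h z) (supportVec θ) : ℝ≥0∞) ∂(privatizedLaw P σ Q θ)

/-- The minimax expected Hamming loss over `Θ_d^+(s,a)`, over all mechanisms in `𝒬_α` and all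
separable selectors. -/
def minimaxHammingRisk (P : Measure ℝ) (σ α : ℝ) (n d s : ℕ) (a : ℝ) : ℝ≥0∞ :=
  ⨅ Q ∈ privateMechanisms α n d, ⨅ h ∈ separableSelectors n d, ⨆ θ ∈ sparseClass d s a,
    hammingRisk P σ Q h θ

open Classical in
/-- The chi-square discrepancy `χ²(μ, ν) = ∫ (dν/dμ - 1)² dμ` if `ν ≪ μ`, and `∞` otherwise. -/
def chiSquare (μ ν : Measure ℝ) : ℝ≥0∞ :=
  if ν ≪ μ then ∫⁻ x, ENNReal.ofReal (((ν.rnDeriv μ x).toReal - 1) ^ 2) ∂μ else ⊤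

/-- `P` has density `exp(-φ)` with respect to Lebesgue measure. -/
def HasPotential (P : Measure ℝ) (φ : ℝ → ℝ) : Prop :=
  P = volume.withDensity (fun x => ENNReal.ofReal (Real.exp (-φ x)))

/-- The curvature of `φ` is bounded from above by `c`. -/
def CurvatureLE (φ : ℝ → ℝ) (c : ℝ) : Prop :=
  ∀ x y t : ℝ, 0 < t → t < 1 →
    φ (t * x + (1 - t) * y) - (t * φ x + (1 - t) * φ y) ≥ -(c / 2) * t * (1 - t) * (x - y) ^ 2

end

/-!
**Lower bound.** Write `e_j` for the `j`-th basis vector. Only the parameters `0` and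
`a e_1, …, a e_d` matter: the supremum of the risk is at least the mean of the risk at `0` and of
the uniform average of the risks at the `a e_j`, so that `2d` times the supremum dominates the sum
over `j` of the weighted testing errors `d ℙ_0(η̂_j = 1) + ℙ_j(η̂_j = 0)`. Here `ℙ_0` and `ℙ_j`
are the laws of the privatized sample under `0` and `a e_j`.

*One test.* With `Λ = dℙ_j/dℙ_0`, the weighted error is at least `∫ min(Λ, d) dℙ_0`, and
`min(Λ, d) ≥ Λ - (Λ log Λ - Λ + 1) / log d` pointwise (`sub_sub_mul_log_div_le_min`). The
likelihood ratio `Λ` is a product of the ratios `L_i` of the single `Z^i`, hence the error is at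
least `1 - (∑ i, ∫ (L_i - 1)²) / log d` (`one_sub_sum_le_testing_error`).

*All tests together.* For a single private kernel `Q`, the chi-square divergences between
`Q P_{a e_j}` and `Q P_0` have a sum over `j` of at most `(e^α - 1)² χ²(P_0, P_a)`, without a
factor `d` (`IsPrivateKernel.sum_integral_sq_le`). This is Bessel's inequality for the functions
`f_j(x) = dP_a/dP_0(x_j) - 1`, which are orthogonal in `L²(P_0)`. It is used in the following dual
form. Put `g_j = d(Q P_{a e_j})/d(Q P_0) - 1` and `F(x, z) = ∑ j, f_j(x) g_j(z)`. The sum in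
question is the difference of the integrals of `F` under the joint law of `(X, Z)` with `X ∼ P_0`
and under the product of its marginals. Privacy bounds each of these laws by `e^α` times the
other, so the difference is at most `(e^α - 1) ∫ |F|`, and orthogonality gives
`(∫ |F|)² ≤ ∫ F² = χ² ∑ j, ∫ g_j²`.

The resulting constants `1/2` and `1` are better than the stated `1/4` and `2`.

**Upper bound on the divergence.** Let `δ = a / σ`. After rescaling,
`1 + χ² = ∫ exp(φ(u) - 2 φ(u - δ)) du`. The curvature bound at the midpoint `u - δ` of `u` and
`u - 2δ` bounds the exponent by `c δ² - φ(u - 2δ)`, and `exp(-φ)` has integral one. The potential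
is measurable because `φ - c x² / 2` is concave, hence continuous.
-/

/-! ### Truncation inequality -/

/-- Truncating a likelihood ratio `x` at level `D` costs at most the entropy integrand divided by
`log D`. This is where the logarithm of the dimension in the lower bound comes from. -/
theorem sub_sub_mul_log_div_le_min {x D : ℝ} (hx : 0 ≤ x) (hD : 1 < D) :
    x - (x * Real.log x - x + 1) / Real.log D ≤ min x D := by
  have hlog : 0 < Real.log D := Real.log_pos hD
  have hD0 : 0 < D := by linarith
  refine le_min ?_ ?_
  · have := Real.self_sub_one_le_mul_log hx
    have : 0 ≤ (x * Real.log x - x + 1) / Real.log D := div_nonneg (by linarith) hlog.le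
    linarith
  · rw [sub_le_iff_le_add, ← sub_le_iff_le_add', le_div_iff₀ hlog]
    have h1 := Real.self_sub_one_le_mul_log hD0.le
    have h2 := Real.self_sub_one_le_mul_log (div_nonneg hx hD0.le)
    have h3 : x - D ≤ x * (Real.log x - Real.log D) := by
      rcases hx.eq_or_lt with rfl | hx
      · simp [hD0.le]
      · rw [Real.log_div hx.ne' hD0.ne', div_mul_eq_mul_div, div_sub_one hD0.ne'] at h2
        exact (div_le_div_iff_of_pos_right hD0).1 h2
    linarith

/-- The entropy integrand of a product of likelihood ratios is bounded by a sum over the factors.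
Factors equal to zero are allowed, since then both sides vanish. -/
theorem prod_mul_log_prod_le {ι : Type*} (s : Finset ι) {l : ι → ℝ} (hl : ∀ i, 0 ≤ l i) :
    (∏ i ∈ s, l i) * Real.log (∏ i ∈ s, l i) ≤ ∑ i ∈ s, (∏ k ∈ s, l k) * (l i - 1) := by
  rw [← Finset.mul_sum]
  by_cases h : ∏ i ∈ s, l i = 0
  · simp [h]
  · have h' := Finset.prod_ne_zero_iff.1 h
    rw [Real.log_prod h']
    refine mul_le_mul_of_nonneg_left (Finset.sum_le_sum fun i hi => ?_)
      (Finset.prod_nonneg fun i _ => hl i)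
    exact Real.log_le_sub_one_of_pos ((hl i).lt_of_ne' (h' i hi))

/-! ### Densities of product measures -/

theorem MeasureTheory.Measure.pi_withDensity {ι : Type*} [Fintype ι] {X : ι → Type*}
    [∀ i, MeasurableSpace (X i)] (μ : ∀ i, Measure (X i)) [∀ i, IsProbabilityMeasure (μ i)]
    (f : ∀ i, X i → ℝ≥0∞) (hf : ∀ i, Measurable (f i))
    [∀ i, SigmaFinite ((μ i).withDensity (f i))] :
    Measure.pi (fun i => (μ i).withDensity (f i)) =
      (Measure.pi μ).withDensity (fun x => ∏ i, f i (x i)) := by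
  refine Measure.pi_eq fun s hs => ?_
  have hg : ∀ i, Measurable ((s i).indicator (f i)) := fun i => (hf i).indicator (hs i)
  rw [withDensity_apply _ (MeasurableSet.univ_pi hs),
    ← lintegral_indicator (MeasurableSet.univ_pi hs)]
  have h : (Set.univ.pi s).indicator (fun x => ∏ i, f i (x i)) =
      fun x => ∏ i, (s i).indicator (f i) (x i) := by
    funext x
    by_cases hx : x ∈ Set.univ.pi s
    · rw [Set.indicator_of_mem hx]
      exact Finset.prod_congr rfl fun i _ => (Set.indicator_of_mem (hx i trivial) _).symm
    · rw [Set.indicator_of_notMem hx]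
      obtain ⟨i, hi⟩ : ∃ i, x i ∉ s i := by simpa [Set.mem_pi] using hx
      exact (Finset.prod_eq_zero (Finset.mem_univ i) (Set.indicator_of_notMem hi _)).symm
  simp only [h]
  refine (lintegral_prod_eq_prod_lintegral_of_indepFun Finset.univ
    (fun i (x : ∀ i, X i) => (s i).indicator (f i) (x i))
    (iIndepFun_pi fun i => (hg i).aemeasurable)
    fun i => (hg i).comp (measurable_pi_apply i)).trans ?_
  refine Finset.prod_congr rfl fun i _ => ?_
  rw [withDensity_apply _ (hs i), ← lintegral_indicator (hs i)]
  exact (measurePreserving_eval μ i).lintegral_comp (hg i)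

/-! ### Testing two product measures -/

/-- Weighted testing error between the product measures `⨂ μ i` and `⨂ L i • μ i`: if the type I
error is weighted by `D`, the error is at least one minus the sum of the chi-square divergences of
the factors divided by `log D`. -/
theorem one_sub_sum_le_testing_error {Z : Type*} [MeasurableSpace Z] {n : ℕ}
    (μ : Fin n → Measure Z) [∀ i, IsProbabilityMeasure (μ i)]
    (L : Fin n → Z → ℝ) {C D : ℝ} (hL : ∀ i, Measurable (L i)) (hL0 : ∀ i z, 0 ≤ L i z)
    (hLC : ∀ i z, L i z ≤ C)
    [∀ i, IsProbabilityMeasure ((μ i).withDensity fun z => ENNReal.ofReal (L i z))]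
    (hD : 1 < D) {A : Set (Fin n → Z)} (hA : MeasurableSet A) :
    1 - (∑ i, ∫ z, (L i z - 1) ^ 2 ∂(μ i)) / Real.log D ≤
      D * (Measure.pi μ).real A +
        (Measure.pi fun i => (μ i).withDensity fun z => ENNReal.ofReal (L i z)).real Aᶜ := by
  have hlog : 0 < Real.log D := Real.log_pos hD
  have hint : ∀ i, Integrable (L i) (μ i) := fun i =>
    Integrable.of_bound (hL i).aestronglyMeasurable C
      (ae_of_all _ fun z => by rw [Real.norm_of_nonneg (hL0 i z)]; exact hLC i z)
  have hmass : ∀ i, ∫ z, L i z ∂(μ i) = 1 := fun i => by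
    rw [integral_eq_lintegral_of_nonneg_ae (ae_of_all _ (hL0 i)) (hL i).aestronglyMeasurable,
      ← setLIntegral_univ, ← withDensity_apply _ MeasurableSet.univ, measure_univ,
      ENNReal.toReal_one]
  have hint1 : ∀ i, Integrable (fun z => L i z - 1) (μ i) := fun i =>
    (hint i).sub (integrable_const 1)
  have hint2 : ∀ i, Integrable (fun z => L i z * (L i z - 1)) (μ i) := fun i =>
    (hint1 i).bdd_mul (hL i).aestronglyMeasurable (c := C)
      (ae_of_all _ fun z => by rw [Real.norm_of_nonneg (hL0 i z)]; exact hLC i z)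
  have hchi : ∀ i, ∫ z, L i z * (L i z - 1) ∂(μ i) = ∫ z, (L i z - 1) ^ 2 ∂(μ i) := fun i => by
    have : ∀ z, (L i z - 1) ^ 2 = L i z * (L i z - 1) - (L i z - 1) := fun z => by ring
    simp_rw [this]
    rw [integral_sub (hint2 i) (hint1 i),
      integral_sub (hint i) (integrable_const 1), hmass]
    simp
  set Λ : (Fin n → Z) → ℝ := fun x => ∏ i, L i (x i) with hΛ
  have hΛ0 : ∀ x, 0 ≤ Λ x := fun x => Finset.prod_nonneg fun i _ => hL0 i _
  have hΛm : Measurable Λ := by fun_prop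
  have hΛint : Integrable Λ (Measure.pi μ) := Integrable.fintype_prod_dep hint
  have hΛmass : ∫ x, Λ x ∂(Measure.pi μ) = 1 := by
    simp [hΛ, integral_fintype_prod_eq_prod, hmass]
  have hν : (Measure.pi fun i => (μ i).withDensity fun z => ENNReal.ofReal (L i z)) =
      (Measure.pi μ).withDensity fun x => ENNReal.ofReal (Λ x) := by
    rw [Measure.pi_withDensity μ _ fun i => (hL i).ennreal_ofReal]
    congr 1
    funext x
    exact (ENNReal.ofReal_prod_of_nonneg fun i _ => hL0 i _).symm
  have hνA : (Measure.pi fun i => (μ i).withDensity fun z => ENNReal.ofReal (L i z)).real Aᶜ =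
      ∫ x in Aᶜ, Λ x ∂(Measure.pi μ) := by
    rw [integral_eq_lintegral_of_nonneg_ae (ae_of_all _ hΛ0) hΛm.aestronglyMeasurable, hν,
      measureReal_def, withDensity_apply _ hA.compl]
  -- the function `Λ(x) (L i (x i) - 1)` is a product of functions of the single coordinates
  set G : Fin n → Fin n → Z → ℝ := fun i k z => L k z * if k = i then L k z - 1 else 1 with hG
  have hfac : ∀ i x, Λ x * (L i (x i) - 1) =
      ∏ k, G i k (x k) := fun i x => by
    simp only [hΛ, hG, Finset.prod_mul_distrib]
    simp
  have hfac_int : ∀ i k, Integrable (G i k) (μ k) := fun i k => by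
    by_cases h : k = i
    · simpa [hG, h] using hint2 i
    · simpa [hG, h] using hint k
  have hterm_int : ∀ i, Integrable (fun x => Λ x * (L i (x i) - 1)) (Measure.pi μ) := fun i => by
    simp_rw [hfac]
    exact Integrable.fintype_prod_dep (hfac_int i)
  have hterm : ∀ i, ∫ x, Λ x * (L i (x i) - 1) ∂(Measure.pi μ) =
      ∫ z, (L i z - 1) ^ 2 ∂(μ i) := fun i => by
    simp_rw [hfac]
    rw [integral_fintype_prod_eq_prod, Finset.prod_eq_single i]
    · simpa [hG] using hchi i
    · intro k _ h
      simpa [hG, h] using hmass k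
    · simp
  have hsum_int : Integrable (fun x => ∑ i, Λ x * (L i (x i) - 1)) (Measure.pi μ) :=
    integrable_finsetSum _ fun i _ => hterm_int i
  have hK_int : Integrable (fun x => ∑ i, Λ x * (L i (x i) - 1) - Λ x + 1) (Measure.pi μ) :=
    (hsum_int.sub hΛint).add (integrable_const 1)
  set T : (Fin n → Z) → ℝ := fun x =>
    Λ x - (∑ i, Λ x * (L i (x i) - 1) - Λ x + 1) / Real.log D with hT
  have hTint : Integrable T (Measure.pi μ) :=
    hΛint.sub (hK_int.div_const _)
  have hTmean : ∫ x, T x ∂(Measure.pi μ) =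
      1 - (∑ i, ∫ z, (L i z - 1) ^ 2 ∂(μ i)) / Real.log D := by
    have hK : ∫ x, (∑ i, Λ x * (L i (x i) - 1) - Λ x + 1) ∂(Measure.pi μ) =
        ∑ i, ∫ z, (L i z - 1) ^ 2 ∂(μ i) := by
      have hsub : Integrable (fun x => ∑ i, Λ x * (L i (x i) - 1) - Λ x) (Measure.pi μ) :=
        hsum_int.sub hΛint
      rw [integral_add hsub (integrable_const 1), integral_sub hsum_int hΛint,
        integral_finsetSum _ fun i _ => hterm_int i, hΛmass]
      simp [hterm]
    rw [← hK, hT, integral_sub hΛint (hK_int.div_const _), integral_div, hΛmass]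
  -- `T` is the integrable lower bound for `min Λ D`
  have hTle : ∀ x, T x ≤ min (Λ x) D := fun x => by
    refine le_trans ?_ (sub_sub_mul_log_div_le_min (hΛ0 x) hD)
    have := prod_mul_log_prod_le Finset.univ (l := fun i => L i (x i)) fun i => hL0 i _
    simp only [hT]
    gcongr
  rw [hνA, ← hTmean, ← integral_add_compl hA hTint]
  refine add_le_add ?_ (integral_mono hTint.integrableOn hΛint.integrableOn
    fun x => (hTle x).trans (min_le_left _ _))
  calc ∫ x in A, T x ∂(Measure.pi μ) ≤ ∫ _ in A, D ∂(Measure.pi μ) :=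
        integral_mono hTint.integrableOn (integrable_const _).integrableOn
          fun x => (hTle x).trans (min_le_right _ _)
    _ = D * (Measure.pi μ).real A := by simp [mul_comm]

/-! ### Measures with comparable values -/

/-- If each of two measures is at most `c` times the other, then integrals of `F` against them
differ by at most `(c - 1) ∫ |F|`. -/
theorem integral_sub_integral_le_of_le_smul {X : Type*} [MeasurableSpace X] {κ π : Measure X}
    {c : ℝ} (hc : 1 ≤ c) (h₁ : κ ≤ ENNReal.ofReal c • π) (h₂ : π ≤ ENNReal.ofReal c • κ)
    {F : X → ℝ} (hF : Integrable F π) :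
    ∫ x, F x ∂κ - ∫ x, F x ∂π ≤ (c - 1) * ∫ x, |F x| ∂π := by
  have hc0 : 0 ≤ c := by linarith
  have hle : ∀ (m₁ m₂ : Measure X), m₁ ≤ ENNReal.ofReal c • m₂ → ∀ G : X → ℝ, Integrable G m₂ →
      (∀ x, 0 ≤ G x) → ∫ x, G x ∂m₁ ≤ c * ∫ x, G x ∂m₂ := fun m₁ m₂ h G hG hG0 => by
    refine (integral_mono_measure h (ae_of_all _ hG0)
      (hG.smul_measure ENNReal.ofReal_ne_top)).trans_eq ?_
    rw [integral_smul_measure, ENNReal.toReal_ofReal hc0, smul_eq_mul]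
  have hFκ : Integrable F κ := (hF.smul_measure ENNReal.ofReal_ne_top).mono_measure h₁
  have hp : ∫ x, max (F x) 0 ∂κ ≤ c * ∫ x, max (F x) 0 ∂π :=
    hle κ π h₁ _ hF.pos_part fun x => le_max_right _ _
  have hn : ∫ x, max (-F x) 0 ∂π ≤ c * ∫ x, max (-F x) 0 ∂κ :=
    hle π κ h₂ _ hFκ.neg_part fun x => le_max_right _ _
  have hn0 : 0 ≤ ∫ x, max (-F x) 0 ∂π := integral_nonneg fun x => le_max_right _ _
  have hsplit : ∀ m : Measure X, Integrable F m →
      ∫ x, F x ∂m = ∫ x, max (F x) 0 ∂m - ∫ x, max (-F x) 0 ∂m := fun m hm => by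
    rw [← integral_sub hm.pos_part hm.neg_part]
    refine integral_congr_ae (ae_of_all _ fun x => ?_)
    simp only
    rcases le_total (F x) 0 with h | h
    · rw [max_eq_right h, max_eq_left (by linarith)]; ring
    · rw [max_eq_left h, max_eq_right (by linarith)]; ring
  have habs : ∫ x, |F x| ∂π = ∫ x, max (F x) 0 ∂π + ∫ x, max (-F x) 0 ∂π := by
    rw [← integral_add hF.pos_part hF.neg_part]
    refine integral_congr_ae (ae_of_all _ fun x => ?_)
    simp only
    rcases le_total (F x) 0 with h | h
    · rw [max_eq_right h, max_eq_left (by linarith), abs_of_nonpos h]; ring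
    · rw [max_eq_left h, max_eq_right (by linarith), abs_of_nonneg h]; ring
  rw [hsplit κ hFκ, hsplit π hF, habs]
  -- on the negative parts, `c⁻¹ ≤ dκ/dπ` suffices because `2 - c ≤ c⁻¹`
  have : (2 - c) * ∫ x, max (-F x) 0 ∂π ≤ ∫ x, max (-F x) 0 ∂κ := by
    have h1 : (2 - c) * (c * ∫ x, max (-F x) 0 ∂κ) ≤ ∫ x, max (-F x) 0 ∂κ := by
      have : 0 ≤ ∫ x, max (-F x) 0 ∂κ := integral_nonneg fun x => le_max_right _ _
      nlinarith [mul_nonneg (sq_nonneg (c - 1)) this]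
    rcases le_total c 2 with h | h
    · exact (mul_le_mul_of_nonneg_left hn (by linarith)).trans h1
    · exact (mul_nonpos_of_nonpos_of_nonneg (by linarith) hn0).trans
        (integral_nonneg fun x => le_max_right _ _)
  linarith

namespace IsPrivateKernel

variable {X Z : Type*} [MeasurableSpace X] [MeasurableSpace Z] {α : ℝ} {Q : Kernel X Z}

theorem bind_le_smul (hQ : IsPrivateKernel α Q) (μ ν : Measure X) [IsProbabilityMeasure μ]
    [IsProbabilityMeasure ν] : μ.bind Q ≤ ENNReal.ofReal (Real.exp α) • ν.bind Q := by
  refine Measure.le_iff.2 fun A hA => ?_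
  rw [Measure.smul_apply, Measure.bind_apply hA Q.aemeasurable,
    Measure.bind_apply hA Q.aemeasurable, smul_eq_mul]
  have h : ∀ x, Q x A ≤ ENNReal.ofReal (Real.exp α) * ∫⁻ y, Q y A ∂ν := fun x => by
    rw [← lintegral_const_mul _ (Q.measurable_coe hA)]
    calc Q x A = ∫⁻ _, Q x A ∂ν := by simp
      _ ≤ _ := lintegral_mono fun y => hQ.2 x y A hA
  calc ∫⁻ x, Q x A ∂μ ≤ ∫⁻ _, ENNReal.ofReal (Real.exp α) * ∫⁻ y, Q y A ∂ν ∂μ := lintegral_mono h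
    _ = _ := by simp

theorem le_smul_bind (hQ : IsPrivateKernel α Q) (μ : Measure X) [IsProbabilityMeasure μ] (x : X) :
    Q x ≤ ENNReal.ofReal (Real.exp α) • μ.bind Q := by
  simpa [Measure.dirac_bind Q.measurable] using hQ.bind_le_smul (Measure.dirac x) μ

theorem bind_le_smul_apply (hQ : IsPrivateKernel α Q) (μ : Measure X) [IsProbabilityMeasure μ]
    (x : X) : μ.bind Q ≤ ENNReal.ofReal (Real.exp α) • Q x := by
  simpa [Measure.dirac_bind Q.measurable] using hQ.bind_le_smul μ (Measure.dirac x)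

/-- The joint law of input and output is at most `e^α` times the product of its marginals. -/
theorem compProd_le_smul_prod (hQ : IsPrivateKernel α Q) (μ : Measure X)
    [IsProbabilityMeasure μ] :
    μ ⊗ₘ Q ≤ ENNReal.ofReal (Real.exp α) • μ.prod (μ.bind Q) := by
  have := hQ.1
  refine Measure.le_iff.2 fun s hs => ?_
  rw [Measure.compProd_apply hs, Measure.smul_apply, Measure.prod_apply hs, smul_eq_mul,
    ← lintegral_const_mul _ (measurable_measure_prodMk_left hs)]
  exact lintegral_mono fun x => hQ.le_smul_bind μ x _

/-- The product of the marginals is at most `e^α` times the joint law of input and output. -/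
theorem prod_le_smul_compProd (hQ : IsPrivateKernel α Q) (μ : Measure X)
    [IsProbabilityMeasure μ] :
    μ.prod (μ.bind Q) ≤ ENNReal.ofReal (Real.exp α) • μ ⊗ₘ Q := by
  have := hQ.1
  refine Measure.le_iff.2 fun s hs => ?_
  rw [Measure.smul_apply, Measure.compProd_apply hs, Measure.prod_apply hs, smul_eq_mul,
    ← lintegral_const_mul _ (Kernel.measurable_kernel_prodMk_left hs)]
  exact lintegral_mono fun x => hQ.bind_le_smul_apply μ x _

/-- Output laws of a private kernel have densities with respect to each other that are bounded by
`e^α`; the density is truncated so that the bound holds everywhere. -/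
theorem exists_bounded_density (hQ : IsPrivateKernel α Q) (μ ν : Measure X)
    [IsProbabilityMeasure μ] [IsProbabilityMeasure ν] :
    ∃ L : Z → ℝ, Measurable L ∧ (∀ z, 0 ≤ L z) ∧ (∀ z, L z ≤ Real.exp α) ∧
      ν.bind Q = (μ.bind Q).withDensity fun z => ENNReal.ofReal (L z) := by
  have := hQ.1
  have hle := hQ.bind_le_smul ν μ
  have hac : ν.bind Q ≪ μ.bind Q := (Measure.absolutelyContinuous_of_le hle).trans
    (Measure.smul_absolutelyContinuous)
  set r := (ν.bind Q).rnDeriv (μ.bind Q) with hr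
  have hrm : Measurable r := Measure.measurable_rnDeriv _ _
  have hbd : ∀ᵐ z ∂(μ.bind Q), r z ≤ ENNReal.ofReal (Real.exp α) := by
    refine ae_le_of_forall_setLIntegral_le_of_sigmaFinite hrm fun s hs _ => ?_
    rw [setLIntegral_const, ← withDensity_apply _ hs, hr, Measure.withDensity_rnDeriv_eq _ _ hac]
    exact hle s
  refine ⟨fun z => min (r z).toReal (Real.exp α), hrm.ennreal_toReal.min measurable_const,
    fun z => le_min ENNReal.toReal_nonneg (Real.exp_pos α).le, fun z => min_le_right _ _, ?_⟩
  conv_lhs => rw [← Measure.withDensity_rnDeriv_eq _ _ hac]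
  refine withDensity_congr_ae ?_
  filter_upwards [hbd] with z hz
  rw [min_eq_left (ENNReal.toReal_le_of_le_ofReal (Real.exp_pos α).le hz),
    ENNReal.ofReal_toReal (ne_top_of_le_ne_top ENNReal.ofReal_ne_top hz)]

end IsPrivateKernel

/-! ### Information contraction under privacy -/

theorem sq_integral_abs_le {X : Type*} [MeasurableSpace X] {μ : Measure X}
    [IsProbabilityMeasure μ] {F : X → ℝ} (hF : Integrable F μ)
    (hF2 : Integrable (fun x => F x ^ 2) μ) :
    (∫ x, |F x| ∂μ) ^ 2 ≤ ∫ x, F x ^ 2 ∂μ := by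
  have h : MemLp (fun x => |F x|) 2 μ :=
    (memLp_two_iff_integrable_sq hF.abs.aestronglyMeasurable).2 (by simpa using hF2)
  have := variance_nonneg (fun x => |F x|) μ
  rw [variance_eq_sub h] at this
  simpa using this

theorem integral_bind_kernel {X Z : Type*} [MeasurableSpace X] [MeasurableSpace Z]
    {μ : Measure X} [SFinite μ] {Q : Kernel X Z} [IsSFiniteKernel Q] {g : Z → ℝ}
    (hg : Integrable g (μ.bind Q)) :
    ∫ z, g z ∂(μ.bind Q) = ∫ x, ∫ z, g z ∂(Q x) ∂μ := by
  have hsnd : Integrable (fun p : X × Z => g p.2) (μ ⊗ₘ Q) :=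
    (Measure.integrable_compProd_snd_iff hg.aestronglyMeasurable).2 hg
  rw [← Measure.integral_compProd hsnd]
  rw [← Measure.snd_compProd, Measure.snd] at hg ⊢
  exact integral_map measurable_snd.aemeasurable hg.aestronglyMeasurable

/-- Bessel-type contraction: if the alternatives `ν j` have densities `1 + f j` with orthogonal
`f j` of common squared norm `V`, then the chi-square divergences of the privatized alternatives
from the privatized null sum up to at most `(e^α - 1)² V`, whatever the number of alternatives. -/
theorem IsPrivateKernel.sum_integral_sq_le {X Z : Type*} [MeasurableSpace X] [MeasurableSpace Z]
    {α : ℝ} (hα : 0 ≤ α) {Q : Kernel X Z} (hQ : IsPrivateKernel α Q) {J : Type*} [Fintype J]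
    [DecidableEq J]
    (μ : Measure X) [IsProbabilityMeasure μ] (ν : J → Measure X) [∀ j, IsProbabilityMeasure (ν j)]
    {f : J → X → ℝ} (hf : ∀ j, Measurable (f j)) (hf1 : ∀ j x, 0 ≤ 1 + f j x)
    (hν : ∀ j, ν j = μ.withDensity fun x => ENNReal.ofReal (1 + f j x))
    (hf2 : ∀ j, MemLp (f j) 2 μ) (hmean : ∀ j, ∫ x, f j x ∂μ = 0)
    {V : ℝ} (hV : 0 ≤ V) (horth : ∀ j k, ∫ x, f j x * f k x ∂μ = if j = k then V else 0)
    {L : J → Z → ℝ} (hL : ∀ j, Measurable (L j)) (hL0 : ∀ j z, 0 ≤ L j z)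
    (hLC : ∀ j z, L j z ≤ Real.exp α)
    (hdens : ∀ j, (ν j).bind Q = (μ.bind Q).withDensity fun z => ENNReal.ofReal (L j z)) :
    ∑ j, ∫ z, (L j z - 1) ^ 2 ∂(μ.bind Q) ≤ (Real.exp α - 1) ^ 2 * V := by
  have := hQ.1
  set m : Measure Z := μ.bind Q with hm
  have : IsProbabilityMeasure m := inferInstanceAs (IsProbabilityMeasure (Q ∘ₘ μ))
  set g : J → Z → ℝ := fun j z => L j z - 1 with hg
  have hgm : ∀ j, Measurable (g j) := fun j => (hL j).sub_const 1
  have hgB : ∀ j z, ‖g j z‖ ≤ Real.exp α + 1 := fun j z => by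
    rw [Real.norm_eq_abs, abs_le]
    have h0 := hL0 j z
    have h1 := hLC j z
    constructor <;> simp only [hg] <;> linarith
  have hg_int : ∀ (η : Measure Z) [IsFiniteMeasure η], ∀ j, Integrable (g j) η := fun η _ j =>
    Integrable.of_bound (hgm j).aestronglyMeasurable _ (ae_of_all _ (hgB j))
  have hgg_int : ∀ j k, Integrable (fun z => g j z * g k z) m := fun j k =>
    (hg_int m k).bdd_mul (hgm j).aestronglyMeasurable (ae_of_all _ (hgB j))
  have hf_int : ∀ j, Integrable (f j) μ := fun j => (hf2 j).integrable one_le_two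
  have hff_int : ∀ j k, Integrable (fun x => f j x * f k x) μ := fun j k =>
    (hf2 j).integrable_mul (hf2 k)
  -- `∫ g² = ∫ g d(Q ν) - ∫ g d(Q μ)`, because `g = L - 1` and `L` is the density of `Q ν`
  have hpair : ∀ j, ∫ x, f j x * ∫ z, g j z ∂(Q x) ∂μ = ∫ z, g j z ^ 2 ∂m := fun j => by
    have hGm : StronglyMeasurable fun x => ∫ z, g j z ∂(Q x) :=
      (hgm j).stronglyMeasurable.integral_kernel
    have hGB : ∀ x, ‖∫ z, g j z ∂(Q x)‖ ≤ Real.exp α + 1 := fun x => by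
      simpa using norm_integral_le_of_norm_le_const (μ := Q x) (ae_of_all _ (hgB j))
    have hG_int : Integrable (fun x => ∫ z, g j z ∂(Q x)) μ :=
      Integrable.of_bound hGm.aestronglyMeasurable _ (ae_of_all _ hGB)
    have hfG_int : Integrable (fun x => f j x * ∫ z, g j z ∂(Q x)) μ :=
      (hf_int j).mul_bdd hGm.aestronglyMeasurable (ae_of_all _ hGB)
    have h0 : ∫ z, g j z ∂m = ∫ x, ∫ z, g j z ∂(Q x) ∂μ := integral_bind_kernel (hg_int m j)
    have : IsProbabilityMeasure ((ν j).bind Q) :=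
      inferInstanceAs (IsProbabilityMeasure (Q ∘ₘ (ν j)))
    have h1 : ∫ z, g j z ∂((ν j).bind Q) = ∫ x, ∫ z, g j z ∂(Q x) ∂(ν j) :=
      integral_bind_kernel (hg_int _ j)
    rw [hdens, hν, integral_withDensity_eq_integral_toReal_smul (by fun_prop) (by simp),
      integral_withDensity_eq_integral_toReal_smul (by fun_prop) (by simp)] at h1
    simp_rw [ENNReal.toReal_ofReal (hL0 j _), ENNReal.toReal_ofReal (hf1 j _), smul_eq_mul,
      add_mul, one_mul] at h1
    rw [integral_add hG_int hfG_int, ← h0] at h1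
    have h2 : ∀ z, g j z ^ 2 = L j z * g j z - g j z := fun z => by simp only [hg]; ring
    have hLg_int : Integrable (fun z => L j z * g j z) m :=
      (hg_int m j).bdd_mul (hL j).aestronglyMeasurable (c := Real.exp α)
        (ae_of_all _ fun z => by rw [Real.norm_of_nonneg (hL0 j z)]; exact hLC j z)
    simp_rw [h2]
    rw [integral_sub hLg_int (hg_int m j)]
    linarith
  set S : ℝ := ∑ j, ∫ z, g j z ^ 2 ∂m with hS
  have hS0 : 0 ≤ S := Finset.sum_nonneg fun j _ => integral_nonneg fun z => sq_nonneg _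
  set F : X × Z → ℝ := fun p => ∑ j, f j p.1 * g j p.2 with hF
  have hterm_prod : ∀ j, Integrable (fun p : X × Z => f j p.1 * g j p.2) (μ.prod m) := fun j =>
    (hf_int j).mul_prod (hg_int m j)
  have hF_prod : Integrable F (μ.prod m) := integrable_finsetSum _ fun j _ => hterm_prod j
  have hKP := hQ.compProd_le_smul_prod μ
  have hterm_comp : ∀ j, Integrable (fun p : X × Z => f j p.1 * g j p.2) (μ ⊗ₘ Q) := fun j =>
    ((hterm_prod j).smul_measure ENNReal.ofReal_ne_top).mono_measure hKP
  -- the pairing of `f` and `g` gives `S` under the joint law and `0` under the product law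
  have hF_comp_mean : ∫ p, F p ∂(μ ⊗ₘ Q) = S := by
    rw [hF, integral_finsetSum _ fun j _ => hterm_comp j]
    refine Finset.sum_congr rfl fun j _ => ?_
    rw [Measure.integral_compProd (hterm_comp j), ← hpair j]
    simp_rw [integral_const_mul]
  have hF_prod_mean : ∫ p, F p ∂(μ.prod m) = 0 := by
    rw [hF, integral_finsetSum _ fun j _ => hterm_prod j]
    refine Finset.sum_eq_zero fun j _ => ?_
    rw [integral_prod_mul, hmean, zero_mul]
  have hF2 : ∀ p, F p ^ 2 = ∑ j, ∑ k, (f j p.1 * f k p.1) * (g j p.2 * g k p.2) := fun p => by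
    simp only [hF, sq, Finset.sum_mul_sum]
    exact Finset.sum_congr rfl fun j _ => Finset.sum_congr rfl fun k _ => by ring
  have hF2_int' : ∀ j k, Integrable
      (fun p : X × Z => (f j p.1 * f k p.1) * (g j p.2 * g k p.2)) (μ.prod m) := fun j k =>
    (hff_int j k).mul_prod (hgg_int j k)
  have hF2_int : Integrable (fun p => F p ^ 2) (μ.prod m) := by
    simp_rw [hF2]
    exact integrable_finsetSum _ fun j _ => integrable_finsetSum _ fun k _ => hF2_int' j k
  have hF2_mean : ∫ p, F p ^ 2 ∂(μ.prod m) = V * S := by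
    simp_rw [hF2]
    rw [integral_finsetSum _ fun j _ => integrable_finsetSum _ fun k _ => hF2_int' j k, hS,
      Finset.mul_sum]
    refine Finset.sum_congr rfl fun j _ => ?_
    rw [integral_finsetSum _ fun k _ => hF2_int' j k, Finset.sum_eq_single j]
    · rw [integral_prod_mul (fun x => f j x * f j x) fun z => g j z * g j z, horth, if_pos rfl]
      simp_rw [sq]
    · intro k _ hk
      rw [integral_prod_mul (fun x => f j x * f k x) fun z => g j z * g k z, horth,
        if_neg hk.symm, zero_mul]
    · simp
  have hA : 0 ≤ Real.exp α - 1 := by linarith [Real.add_one_le_exp α]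
  have h1 : S ≤ (Real.exp α - 1) * ∫ p, |F p| ∂(μ.prod m) := by
    have := integral_sub_integral_le_of_le_smul (Real.one_le_exp hα) hKP
      (hQ.prod_le_smul_compProd μ) hF_prod
    rwa [hF_comp_mean, hF_prod_mean, sub_zero] at this
  have h2 := sq_integral_abs_le hF_prod hF2_int
  rw [hF2_mean] at h2
  rcases hS0.eq_or_lt with h | h
  · rw [← h]; positivity
  · refine le_of_mul_le_mul_right ?_ h
    calc S * S = S ^ 2 := (sq S).symm
      _ ≤ ((Real.exp α - 1) * ∫ p, |F p| ∂(μ.prod m)) ^ 2 := pow_le_pow_left₀ hS0 h1 2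
      _ = (Real.exp α - 1) ^ 2 * (∫ p, |F p| ∂(μ.prod m)) ^ 2 := mul_pow _ _ _
      _ ≤ (Real.exp α - 1) ^ 2 * (V * S) := by gcongr
      _ = _ := by ring

/-! ### Potentials with curvature bounded from above -/

/-- A curvature bound from above is concavity of `φ - c x² / 2`, and a concave function on the line
is continuous. -/
theorem CurvatureLE.continuous {φ : ℝ → ℝ} {c : ℝ} (h : CurvatureLE φ c) : Continuous φ := by
  have hc : ConcaveOn ℝ Set.univ fun x => φ x - c / 2 * x ^ 2 := by
    refine concaveOn_iff_forall_pos.2 ⟨convex_univ, fun x _ y _ s t hs ht hst => ?_⟩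
    obtain rfl : t = 1 - s := by linarith
    have := h x y s hs (by linarith)
    simp only [smul_eq_mul]
    linarith
  have hcont : Continuous fun x => φ x - c / 2 * x ^ 2 :=
    continuousOn_univ.1 (hc.continuousOn isOpen_univ)
  have : φ = fun x => (φ x - c / 2 * x ^ 2) + c / 2 * x ^ 2 := by funext x; ring
  rw [this]
  fun_prop

/-- The curvature bound at the midpoint `u - δ` of `u` and `u - 2δ`. -/
theorem CurvatureLE.sub_two_mul_le {φ : ℝ → ℝ} {c : ℝ} (h : CurvatureLE φ c) (u δ : ℝ) :
    φ u - 2 * φ (u - δ) ≤ c * δ ^ 2 - φ (u - 2 * δ) := by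
  have := h u (u - 2 * δ) (1 / 2) (by norm_num) (by norm_num)
  have e : 1 / 2 * u + (1 - 1 / 2) * (u - 2 * δ) = u - δ := by ring
  rw [e] at this
  linarith

theorem isProbabilityMeasure_coordLaw (P : Measure ℝ) [IsProbabilityMeasure P] (σ t : ℝ) :
    IsProbabilityMeasure (coordLaw P σ t) :=
  Measure.isProbabilityMeasure_map (by fun_prop)

theorem lintegral_coordLaw_of_hasPotential {P : Measure ℝ} {φ : ℝ → ℝ} (hP : HasPotential P φ)
    (hφ : Continuous φ) (σ t : ℝ) {g : ℝ → ℝ≥0∞} (hg : Measurable g) :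
    ∫⁻ x, g x ∂(coordLaw P σ t) =
      ∫⁻ u, ENNReal.ofReal (Real.exp (-φ u)) * g (t + σ * u) := by
  rw [coordLaw, lintegral_map hg (by fun_prop), hP,
    lintegral_withDensity_eq_lintegral_mul _ (by fun_prop) (by fun_prop)]
  rfl

theorem coordLaw_eq_withDensity {P : Measure ℝ} {φ : ℝ → ℝ} (hP : HasPotential P φ)
    (hφ : Continuous φ) {σ : ℝ} (hσ : 0 < σ) (a : ℝ) :
    coordLaw P σ a = (coordLaw P σ 0).withDensity fun x =>
      ENNReal.ofReal (Real.exp (φ (x / σ) - φ (x / σ - a / σ))) := by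
  refine Measure.ext fun s hs => ?_
  have hm : Measurable fun x => ENNReal.ofReal (Real.exp (φ (x / σ) - φ (x / σ - a / σ))) := by
    fun_prop
  rw [withDensity_apply _ hs, ← lintegral_indicator hs, ← lintegral_indicator_one hs,
    lintegral_coordLaw_of_hasPotential hP hφ _ _ (measurable_one.indicator hs),
    lintegral_coordLaw_of_hasPotential hP hφ _ _ (hm.indicator hs),
    ← lintegral_sub_right_eq_self _ (a / σ)]
  refine lintegral_congr fun u => ?_
  have e : a + σ * (u - a / σ) = 0 + σ * u := by field_simp; ring
  rw [e]
  by_cases h : 0 + σ * u ∈ s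
  · rw [Set.indicator_of_mem h, Set.indicator_of_mem h,
      ← ENNReal.ofReal_mul (Real.exp_pos _).le, ← Real.exp_add, zero_add,
      mul_div_cancel_left₀ _ hσ.ne', Pi.one_apply, mul_one]
    congr 2
    ring
  · rw [Set.indicator_of_notMem h, Set.indicator_of_notMem h, mul_zero, mul_zero]

theorem chiSquare_add_one {μ ν : Measure ℝ} [IsProbabilityMeasure μ] [IsProbabilityMeasure ν]
    {w : ℝ → ℝ} (hw : Measurable w) (hw0 : ∀ x, 0 ≤ w x)
    (hν : ν = μ.withDensity fun x => ENNReal.ofReal (w x)) :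
    chiSquare μ ν + 1 = ∫⁻ x, ENNReal.ofReal (w x ^ 2) ∂μ := by
  have hac : ν ≪ μ := hν ▸ withDensity_absolutelyContinuous _ _
  have hr : ν.rnDeriv μ =ᵐ[μ] fun x => ENNReal.ofReal (w x) := by
    rw [hν]; exact Measure.rnDeriv_withDensity μ hw.ennreal_ofReal
  have hchi : chiSquare μ ν = ∫⁻ x, ENNReal.ofReal ((w x - 1) ^ 2) ∂μ := by
    rw [chiSquare, if_pos hac]
    refine lintegral_congr_ae ?_
    filter_upwards [hr] with x hx
    rw [hx, ENNReal.toReal_ofReal (hw0 x)]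
  have hmass : ∫⁻ x, ENNReal.ofReal (w x) ∂μ = 1 := by
    rw [← setLIntegral_univ, ← withDensity_apply _ MeasurableSet.univ, ← hν, measure_univ]
  have key : ∫⁻ x, (ENNReal.ofReal ((w x - 1) ^ 2) + 2 * ENNReal.ofReal (w x)) ∂μ =
      ∫⁻ x, (ENNReal.ofReal (w x ^ 2) + 1) ∂μ := by
    refine lintegral_congr fun x => ?_
    rw [← ENNReal.ofReal_ofNat, ← ENNReal.ofReal_one, ← ENNReal.ofReal_mul (by norm_num),
      ← ENNReal.ofReal_add (sq_nonneg _) (by have := hw0 x; positivity),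
      ← ENNReal.ofReal_add (sq_nonneg _) zero_le_one]
    congr 1
    ring
  rw [lintegral_add_right _ (by fun_prop), lintegral_add_right _ (by fun_prop),
    lintegral_const_mul _ (by fun_prop), hmass, ← hchi] at key
  simp only [mul_one, lintegral_const, measure_univ] at key
  -- `χ² + 2 = ∫ w² + 1`; cancel one
  rw [← one_add_one_eq_two, ← add_assoc] at key
  exact (ENNReal.add_left_inj ENNReal.one_ne_top).1 key

theorem chiSquare_coordLaw_le {P : Measure ℝ} [IsProbabilityMeasure P] {φ : ℝ → ℝ} {c : ℝ}
    (hP : HasPotential P φ) (hφ : CurvatureLE φ c) {σ : ℝ} (hσ : 0 < σ) (a : ℝ) :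
    chiSquare (coordLaw P σ 0) (coordLaw P σ a) ≤
      ENNReal.ofReal (Real.exp (c * (a / σ) ^ 2) - 1) := by
  have hcont := hφ.continuous
  have := isProbabilityMeasure_coordLaw P σ
  have hmass : ∫⁻ u, ENNReal.ofReal (Real.exp (-φ u)) = 1 := by
    rw [← setLIntegral_univ, ← withDensity_apply _ MeasurableSet.univ, ← hP, measure_univ]
  have hchi := chiSquare_add_one (by fun_prop) (fun x => (Real.exp_pos _).le)
    (coordLaw_eq_withDensity hP hcont hσ a)
  rw [lintegral_coordLaw_of_hasPotential hP hcont _ _ (by fun_prop)] at hchi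
  rw [ENNReal.ofReal_sub _ zero_le_one, ENNReal.ofReal_one]
  refine ENNReal.le_sub_of_add_le_right ENNReal.one_ne_top ?_
  rw [hchi]
  calc ∫⁻ u, ENNReal.ofReal (Real.exp (-φ u)) * ENNReal.ofReal
          (Real.exp (φ ((0 + σ * u) / σ) - φ ((0 + σ * u) / σ - a / σ)) ^ 2)
      ≤ ∫⁻ u, ENNReal.ofReal (Real.exp (c * (a / σ) ^ 2)) *
          ENNReal.ofReal (Real.exp (-φ (u - 2 * (a / σ)))) := lintegral_mono fun u => by
        rw [zero_add, mul_div_cancel_left₀ _ hσ.ne', ← ENNReal.ofReal_mul (Real.exp_pos _).le,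
          ← ENNReal.ofReal_mul (Real.exp_pos _).le, ← Real.exp_nat_mul, ← Real.exp_add,
          ← Real.exp_add]
        refine ENNReal.ofReal_le_ofReal (Real.exp_le_exp.2 ?_)
        have := hφ.sub_two_mul_le u (a / σ)
        push_cast
        linarith
    _ = ENNReal.ofReal (Real.exp (c * (a / σ) ^ 2)) := by
        rw [lintegral_const_mul _ (by fun_prop),
          lintegral_sub_right_eq_self (fun u => ENNReal.ofReal (Real.exp (-φ u))), hmass, mul_one]

/-! ### The sparse shift model -/

theorem isProbabilityMeasure_obsLaw (P : Measure ℝ) [IsProbabilityMeasure P] (σ : ℝ) {d : ℕ}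
    (θ : Fin d → ℝ) : IsProbabilityMeasure (obsLaw P σ θ) := by
  have := isProbabilityMeasure_coordLaw P σ
  unfold obsLaw
  infer_instance

theorem withDensity_toReal_rnDeriv {X : Type*} [MeasurableSpace X] {μ ν : Measure X}
    [SigmaFinite μ] [SigmaFinite ν] (h : ν ≪ μ) :
    μ.withDensity (fun x => ENNReal.ofReal (ν.rnDeriv μ x).toReal) = ν := by
  conv_rhs => rw [← Measure.withDensity_rnDeriv_eq _ _ h]
  refine withDensity_congr_ae ?_
  filter_upwards [Measure.rnDeriv_lt_top ν μ] with x hx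
  exact ENNReal.ofReal_toReal hx.ne

theorem obsLaw_single_eq_withDensity {P : Measure ℝ} [IsProbabilityMeasure P] {σ a : ℝ} {d : ℕ}
    (h : coordLaw P σ a ≪ coordLaw P σ 0) (j : Fin d) :
    obsLaw P σ (Pi.single j a) = (obsLaw P σ (0 : Fin d → ℝ)).withDensity fun x =>
      ENNReal.ofReal ((coordLaw P σ a).rnDeriv (coordLaw P σ 0) (x j)).toReal := by
  have := isProbabilityMeasure_coordLaw P σ
  set r : ℝ → ℝ≥0∞ := fun x =>
    ENNReal.ofReal ((coordLaw P σ a).rnDeriv (coordLaw P σ 0) x).toReal with hr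
  have hrm : Measurable r := (Measure.measurable_rnDeriv _ _).ennreal_toReal.ennreal_ofReal
  have hk : ∀ k, coordLaw P σ ((Pi.single j a : Fin d → ℝ) k) =
      (coordLaw P σ 0).withDensity (if k = j then r else 1) := fun k => by
    by_cases hkj : k = j
    · subst hkj
      rw [Pi.single_eq_same, if_pos rfl, hr, withDensity_toReal_rnDeriv h]
    · rw [Pi.single_eq_of_ne hkj, if_neg hkj, withDensity_one]
  have : ∀ k, IsProbabilityMeasure ((coordLaw P σ 0).withDensity (if k = j then r else 1)) :=
    fun k => hk k ▸ inferInstance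
  unfold obsLaw
  simp only [hk, Pi.zero_apply]
  rw [Measure.pi_withDensity (fun _ => coordLaw P σ 0) _ fun k => by
    by_cases hkj : k = j
    · simpa [hkj] using hrm
    · simpa [hkj] using measurable_one]
  congr 1
  funext x
  rw [Finset.prod_eq_single j]
  · simp [hr]
  · intro k _ hkj
    simp [hkj]
  · simp

theorem absolutelyContinuous_of_chiSquare_lt_top {μ ν : Measure ℝ} (h : chiSquare μ ν < ⊤) :
    ν ≪ μ := by
  by_contra hac
  simp [chiSquare, hac] at h

theorem measurable_toReal_rnDeriv_sub_one (μ ν : Measure ℝ) :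
    Measurable fun x => (ν.rnDeriv μ x).toReal - 1 :=
  (Measure.measurable_rnDeriv _ _).ennreal_toReal.sub_const 1

theorem integral_sub_one_sq_eq_chiSquare {μ ν : Measure ℝ} (h : ν ≪ μ) :
    ∫ x, ((ν.rnDeriv μ x).toReal - 1) ^ 2 ∂μ = (chiSquare μ ν).toReal := by
  rw [chiSquare, if_pos h, integral_eq_lintegral_of_nonneg_ae (ae_of_all _ fun x => sq_nonneg _)
    ((measurable_toReal_rnDeriv_sub_one μ ν).pow_const 2).aestronglyMeasurable]

theorem memLp_rnDeriv_sub_one {μ ν : Measure ℝ} [IsFiniteMeasure μ] (h : chiSquare μ ν < ⊤) :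
    MemLp (fun x => (ν.rnDeriv μ x).toReal - 1) 2 μ := by
  have hac := absolutelyContinuous_of_chiSquare_lt_top h
  have hm := measurable_toReal_rnDeriv_sub_one μ ν
  refine (memLp_two_iff_integrable_sq hm.aestronglyMeasurable).2
    ⟨(hm.pow_const 2).aestronglyMeasurable, ?_⟩
  rw [chiSquare, if_pos hac] at h
  rwa [hasFiniteIntegral_iff_ofReal (ae_of_all _ fun x => sq_nonneg _)]

/-! ### Lower bound on the Hamming risk -/

/-- A private kernel applied to the one-sparse alternatives `a e_j`: the privatized laws have
bounded densities with respect to the privatized null, and their chi-square divergences sum up to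
at most `(e^α - 1)² χ²(P_0, P_a)`. -/
theorem exists_density_sum_integral_sq_le {P : Measure ℝ} [IsProbabilityMeasure P] {σ a α : ℝ}
    {d : ℕ} (hchi : chiSquare (coordLaw P σ 0) (coordLaw P σ a) < ⊤) (hα : 0 ≤ α)
    {Q : Kernel (Fin d → ℝ) (Fin d → ℝ)} (hQ : IsPrivateKernel α Q) :
    ∃ L : Fin d → (Fin d → ℝ) → ℝ, (∀ j, Measurable (L j)) ∧ (∀ j z, 0 ≤ L j z) ∧
      (∀ j z, L j z ≤ Real.exp α) ∧
      (∀ j, (obsLaw P σ (Pi.single j a)).bind Q =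
        ((obsLaw P σ (0 : Fin d → ℝ)).bind Q).withDensity fun z => ENNReal.ofReal (L j z)) ∧
      ∑ j, ∫ z, (L j z - 1) ^ 2 ∂((obsLaw P σ (0 : Fin d → ℝ)).bind Q) ≤
        (Real.exp α - 1) ^ 2 * (chiSquare (coordLaw P σ 0) (coordLaw P σ a)).toReal := by
  have hcoord := isProbabilityMeasure_coordLaw P σ
  have hobs := fun θ : Fin d → ℝ => isProbabilityMeasure_obsLaw P σ θ
  have hac := absolutelyContinuous_of_chiSquare_lt_top hchi
  choose L hL hL0 hLC hdens using fun j : Fin d =>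
    hQ.exists_bounded_density (obsLaw P σ (0 : Fin d → ℝ)) (obsLaw P σ (Pi.single j a))
  refine ⟨L, hL, hL0, hLC, hdens, ?_⟩
  set μ₀ := coordLaw P σ 0
  set f : ℝ → ℝ := fun x => ((coordLaw P σ a).rnDeriv μ₀ x).toReal - 1 with hf
  have hfm : Measurable f := measurable_toReal_rnDeriv_sub_one _ _
  have hf2 : MemLp f 2 μ₀ := memLp_rnDeriv_sub_one hchi
  have hmean : ∫ x, f x ∂μ₀ = 0 := by
    rw [hf, integral_sub Measure.integrable_toReal_rnDeriv (integrable_const 1),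
      Measure.integral_toReal_rnDeriv hac]
    simp
  have hμ : obsLaw P σ (0 : Fin d → ℝ) = Measure.pi fun _ => μ₀ := rfl
  have hcoordmean : ∀ (j : Fin d), ∫ x, f (x j) ∂(obsLaw P σ (0 : Fin d → ℝ)) = 0 := fun j => by
    rw [hμ, integral_comp_eval (μ := fun _ : Fin d => μ₀) hfm.aestronglyMeasurable, hmean]
  refine hQ.sum_integral_sq_le hα _ (fun j => obsLaw P σ (Pi.single j a))
    (f := fun j x => f (x j)) (fun j => by fun_prop) (fun j x => ?_) (fun j => ?_) (fun j => ?_)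
    hcoordmean ENNReal.toReal_nonneg (fun j k => ?_) hL hL0 hLC hdens
  · simp [hf]
  · rw [obsLaw_single_eq_withDensity hac]
    simp [hf, μ₀]
  · exact hf2.comp_measurePreserving (measurePreserving_eval (fun _ : Fin d => μ₀) j)
  · split_ifs with hjk
    · subst hjk
      rw [← integral_sub_one_sq_eq_chiSquare hac, hμ]
      simp_rw [← sq]
      exact integral_comp_eval (μ := fun _ : Fin d => μ₀) (f := fun x => f x ^ 2)
        (hfm.pow_const 2).aestronglyMeasurable
    · have hind : IndepFun (fun x : Fin d → ℝ => f (x j)) (fun x => f (x k))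
          (obsLaw P σ (0 : Fin d → ℝ)) :=
        (iIndepFun_pi (μ := fun _ : Fin d => μ₀) (X := fun _ => f)
          fun _ => hfm.aemeasurable).indepFun hjk
      rw [hind.integral_fun_mul_eq_mul_integral
        (hfm.comp (measurable_pi_apply j)).aestronglyMeasurable
        (hfm.comp (measurable_pi_apply k)).aestronglyMeasurable, hcoordmean, zero_mul]

theorem sum_measure_le_hammingRisk_zero {P : Measure ℝ} {σ : ℝ} {n d : ℕ}
    {Q : Fin n → Kernel (Fin d → ℝ) (Fin d → ℝ)} {h : (Fin n → Fin d → ℝ) → (Fin d → Bool)}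
    (hh : Measurable h) :
    ∑ j, privatizedLaw P σ Q 0 {z | h z j = true} ≤ hammingRisk P σ Q h 0 := by
  have hm : ∀ j, MeasurableSet {z | h z j = true} := fun j =>
    ((measurable_pi_apply j).comp hh) (measurableSet_singleton true)
  have h1 : ∀ j, privatizedLaw P σ Q 0 {z | h z j = true} =
      ∫⁻ z, {z | h z j = true}.indicator 1 z ∂(privatizedLaw P σ Q 0) := fun j =>
    (lintegral_indicator_one (hm j)).symm
  simp_rw [h1]
  rw [← lintegral_finsetSum _ fun j _ => measurable_one.indicator (hm j)]
  refine lintegral_mono fun z => le_of_eq ?_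
  simp [hammingDist, supportVec, Set.indicator_apply, Finset.sum_boole]

theorem measure_le_hammingRisk_single {P : Measure ℝ} {σ a : ℝ} (ha : a ≠ 0) {n d : ℕ}
    {Q : Fin n → Kernel (Fin d → ℝ) (Fin d → ℝ)} {h : (Fin n → Fin d → ℝ) → (Fin d → Bool)}
    (hh : Measurable h) (j : Fin d) :
    privatizedLaw P σ Q (Pi.single j a) {z | h z j = true}ᶜ ≤
      hammingRisk P σ Q h (Pi.single j a) := by
  have hm : MeasurableSet {z | h z j = true}ᶜ :=
    (((measurable_pi_apply j).comp hh) (measurableSet_singleton true)).compl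
  rw [← lintegral_indicator_one hm]
  refine lintegral_mono fun z => ?_
  by_cases hz : h z j = true
  · simp [hz]
  · have hne : h z ≠ supportVec (Pi.single j a) := fun e => hz (by simp [e, supportVec, ha])
    have := hammingDist_pos.2 hne
    rw [Set.indicator_of_mem hz, Pi.one_apply]
    exact Nat.one_le_cast.2 this

/-- Lower bound on the maximal risk of a fixed mechanism and a fixed measurable selector. -/
theorem ofReal_le_iSup_hammingRisk {P : Measure ℝ} [IsProbabilityMeasure P] {σ a α : ℝ}
    (ha : 0 < a) (hα : 0 ≤ α)
    (hchi : chiSquare (coordLaw P σ 0) (coordLaw P σ a) < ⊤) {d s n : ℕ} (hd : 1 < d)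
    (hs : 1 ≤ s) {Q : Fin n → Kernel (Fin d → ℝ) (Fin d → ℝ)} (hQ : Q ∈ privateMechanisms α n d)
    {h : (Fin n → Fin d → ℝ) → (Fin d → Bool)} (hh : Measurable h) :
    ENNReal.ofReal ((1 / 2 : ℝ) * (1 - (n : ℝ) * (Real.exp α - 1) ^ 2 /
      ((d : ℝ) * Real.log (d : ℝ)) * (chiSquare (coordLaw P σ 0) (coordLaw P σ a)).toReal)) ≤
      ⨆ θ ∈ sparseClass d s a, hammingRisk P σ Q h θ := by
  have hobs := fun θ : Fin d → ℝ => isProbabilityMeasure_obsLaw P σ θ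
  have hQm : ∀ i, IsMarkovKernel (Q i) := fun i => (hQ i).1
  have hprob : ∀ i (θ : Fin d → ℝ), IsProbabilityMeasure ((obsLaw P σ θ).bind (Q i)) := fun i θ =>
    inferInstanceAs (IsProbabilityMeasure (Q i ∘ₘ obsLaw P σ θ))
  have hpriv : ∀ θ, IsProbabilityMeasure (privatizedLaw P σ Q θ) := fun θ => by
    unfold privatizedLaw; infer_instance
  set V := (chiSquare (coordLaw P σ 0) (coordLaw P σ a)).toReal
  have hd' : (1 : ℝ) < d := by exact_mod_cast hd
  have hlog : 0 < Real.log d := Real.log_pos hd'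
  have hA : ∀ j, MeasurableSet {z | h z j = true} := fun j =>
    ((measurable_pi_apply j).comp hh) (measurableSet_singleton true)
  choose L hL hL0 hLC hdens hsum using fun i => exists_density_sum_integral_sq_le hchi hα (hQ i)
  have htest : ∀ j, 1 - (∑ i, ∫ z, (L i j z - 1) ^ 2 ∂((obsLaw P σ (0 : Fin d → ℝ)).bind (Q i))) /
      Real.log d ≤ d * (privatizedLaw P σ Q 0).real {z | h z j = true} +
        (privatizedLaw P σ Q (Pi.single j a)).real {z | h z j = true}ᶜ := fun j => by
    have : ∀ i, IsProbabilityMeasure (((obsLaw P σ (0 : Fin d → ℝ)).bind (Q i)).withDensity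
        fun z => ENNReal.ofReal (L i j z)) := fun i => hdens i j ▸ inferInstance
    have := one_sub_sum_le_testing_error (fun i => (obsLaw P σ (0 : Fin d → ℝ)).bind (Q i))
      (fun i => L i j) (fun i => hL i j) (fun i => hL0 i j) (fun i => hLC i j) hd' (hA j)
    simpa only [privatizedLaw, hdens] using this
  set R := ⨆ θ ∈ sparseClass d s a, hammingRisk P σ Q h θ with hR
  by_cases hRtop : R = ⊤
  · rw [hRtop]; exact le_top
  have h0 : ∑ j, (privatizedLaw P σ Q 0).real {z | h z j = true} ≤ R.toReal := by
    simp_rw [measureReal_def]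
    rw [← ENNReal.toReal_sum fun j _ => measure_ne_top _ _]
    refine ENNReal.toReal_mono hRtop ((sum_measure_le_hammingRisk_zero hh).trans ?_)
    exact le_iSup₂_of_le 0 ⟨∅, by simp, by simp, by simp⟩ le_rfl
  have h1 : ∀ j, (privatizedLaw P σ Q (Pi.single j a)).real {z | h z j = true}ᶜ ≤ R.toReal :=
    fun j => by
      refine ENNReal.toReal_mono hRtop ((measure_le_hammingRisk_single ha.ne' hh j).trans ?_)
      refine le_iSup₂_of_le (Pi.single j a) ⟨{j}, by simpa using hs, by simp, ?_⟩ le_rfl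
      intro k hk
      have hkj : k ≠ j := by simpa using hk
      simp [hkj]
  have hchi_sum : ∑ j, ∑ i, ∫ z, (L i j z - 1) ^ 2 ∂((obsLaw P σ (0 : Fin d → ℝ)).bind (Q i)) ≤
      n * ((Real.exp α - 1) ^ 2 * V) := by
    rw [Finset.sum_comm]
    refine (Finset.sum_le_sum fun i _ => hsum i).trans_eq ?_
    simp [V]
  -- the risk at `0` bounds the sum of the type I errors,
  -- the risk at `a e_j` the `j`-th type II error
  have htot : d - n * ((Real.exp α - 1) ^ 2 * V) / Real.log d ≤ 2 * d * R.toReal := by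
    calc d - n * ((Real.exp α - 1) ^ 2 * V) / Real.log d
        ≤ d - (∑ j, ∑ i, ∫ z, (L i j z - 1) ^ 2 ∂((obsLaw P σ (0 : Fin d → ℝ)).bind (Q i))) /
            Real.log d := by gcongr
      _ = ∑ j : Fin d, (1 - (∑ i, ∫ z, (L i j z - 1) ^ 2
            ∂((obsLaw P σ (0 : Fin d → ℝ)).bind (Q i))) / Real.log d) := by
          rw [Finset.sum_sub_distrib, Finset.sum_div]
          simp
      _ ≤ ∑ j : Fin d, (d * (privatizedLaw P σ Q 0).real {z | h z j = true} + R.toReal) :=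
          Finset.sum_le_sum fun j _ => (htest j).trans (by gcongr; exact h1 j)
      _ = d * ∑ j, (privatizedLaw P σ Q 0).real {z | h z j = true} + d * R.toReal := by
          rw [Finset.sum_add_distrib, Finset.mul_sum]
          simp
      _ ≤ d * R.toReal + d * R.toReal := by gcongr
      _ = 2 * d * R.toReal := by ring
  refine ENNReal.ofReal_le_of_le_toReal ?_
  have hd0 : (0 : ℝ) < d := by linarith
  refine le_of_mul_le_mul_left (htot.trans' (le_of_eq ?_)) (by positivity : (0 : ℝ) < 2 * d)
  field_simp

theorem mainTheorem2 (P : Measure ℝ) [IsProbabilityMeasure P] (σ a : ℝ) (hσ : 0 < σ)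
    (ha : 0 < a) :
    (chiSquare (coordLaw P σ 0) (coordLaw P σ a) < ⊤ →
      ∀ (α : ℝ) (d s n : ℕ), 0 < α → 4 ≤ d → 1 ≤ s → s ≤ d → 1 ≤ n →
        ENNReal.ofReal ((1 / 4 : ℝ) * (1 - 2 * (n : ℝ) * (Real.exp α - 1) ^ 2 /
            ((d : ℝ) * Real.log (d : ℝ)) *
            (chiSquare (coordLaw P σ 0) (coordLaw P σ a)).toReal))
          ≤ minimaxHammingRisk P σ α n d s a) ∧
    (∀ (φ : ℝ → ℝ) (cplus : ℝ), 0 < cplus → HasPotential P φ → CurvatureLE φ cplus →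
      chiSquare (coordLaw P σ 0) (coordLaw P σ a)
        ≤ ENNReal.ofReal (Real.exp (cplus * (a / σ) ^ 2) - 1)) := by
  refine ⟨fun hchi α d s n hα hd hs _ _ => ?_, fun φ cplus _ hP hφ =>
    chiSquare_coordLaw_le hP hφ hσ a⟩
  refine le_iInf₂ fun Q hQ => le_iInf₂ fun h hh => ?_
  refine le_trans (ENNReal.ofReal_le_ofReal ?_)
    (ofReal_le_iSup_hammingRisk ha hα.le hchi (by omega) hs hQ hh.1)
  rw [mul_assoc 2, mul_div_assoc 2, mul_assoc 2]
  linarith
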